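/- Let $n\ge 1$ and $[n]=\{1,\dots,n\}$. A weighted partition of $[n]$ is a set $\{B_1^{v_1},\dots,B_t^{v_t}\}$ where $\{B_1,\dots,B_t\}$ is a partition of $[n]$ (into nonempty blocks) and $v_j\in\{0,1,\dots,|B_j|-1\}$ for all $j$. Let $\Pi_n^w$ be the poset of weighted partitions of $[n]$, in which $\{A_1^{w_1},\dots,A_s^{w_s}\}\le\{B_1^{v_1},\dots,B_t^{v_t}\}$ if and only if every $A_j$ is contained in some $B_k$ and, whenever $B_k=A_{i_1}\cup\dots\cup A_{i_l}$ with distinct $i_1,\dots,i_l$, we have $v_k-(w_{i_1}+\dots+w_{i_l})\in\{0,1,\dots,l-1\}$. Write $\hat 0=\{\{1\}^0,\dots,\{n\}^0\}$ for its minimum element and $[n]^i$ for the weighted partition with the single block $[n]$ of weight $i$ ($0\le i\le n-1$), and let $\mu_{\Pi_n^w}$ be the Möbius function of $\Pi_n^w$. A descent of a rooted tree $T$ on node set $[n]$ is a non-root node whose label is smaller than the label of its parent in $T$. Let $\mathcal T_{n,i}$ be the set of rooted trees on node set $[n]$ with exactly $i$ descents. Then for all $n\ge 1$ and all $i\in\{0,1,\dots,n-1\}$,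 $$\mu_{\Pi_n^w}(\hat 0,[n]^i)=(-1)^{n-1}\,|\mathcal T_{n,i}|.$$ -/

import Mathlib

/-- A weighted partition of `[n]` (modelled by `Fin n`): a partition of `[n]` together with a weight
in `{0, 1, ..., |B| - 1}` for each block `B`. The weight is stored as a function on all finsets,
normalised to be `0` on the finsets that are not blocks, so that two weighted partitions
are equal exactly when they have the same weighted blocks. -/
@[ext]
structure WeightedPartition (n : ℕ) where
  partition : Finpartition (Finset.univ : Finset (Fin n))
  weight : Finset (Fin n) → ℕ
  weight_lt : ∀ B ∈ partition.parts, weight B < B.card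
  weight_eq_zero : ∀ B ∉ partition.parts, weight B = 0

namespace WeightedPartition

variable {n : ℕ}

/-- The blocks of the weighted partition `α` that are contained in `B`. -/
def blocksIn (α : WeightedPartition n) (B : Finset (Fin n)) : Finset (Finset (Fin n)) :=
  α.partition.parts.filter (fun A => A ⊆ B)

/-- The order of weighted partitions: the underlying partitions are ordered by refinement and, for
each block `B` of `β`, if `B` is the union of the blocks `A₁, ..., A_l` of `α`, then the weight of
`B` minus the sum of the weights of the `A_j` lies in `{0, 1, ..., l - 1}`. -/
instance : LE (WeightedPartition n) where
  le α β := α.partition ≤ β.partition ∧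
    ∀ B ∈ β.partition.parts,
      ∃ d < (α.blocksIn B).card, β.weight B = (∑ A ∈ α.blocksIn B, α.weight A) + d

theorem le_def (α β : WeightedPartition n) : α ≤ β ↔ α.partition ≤ β.partition ∧
    ∀ B ∈ β.partition.parts,
      ∃ d < (α.blocksIn B).card, β.weight B = (∑ A ∈ α.blocksIn B, α.weight A) + d :=
  Iff.rfl

theorem mem_blocksIn {α : WeightedPartition n} {A B : Finset (Fin n)} :
    A ∈ α.blocksIn B ↔ A ∈ α.partition.parts ∧ A ⊆ B := by
  simp [blocksIn]

/-- Two blocks of a partition with one contained in the other are equal. -/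
theorem part_eq_of_subset {P : Finpartition (Finset.univ : Finset (Fin n))} {A B : Finset (Fin n)}
    (hA : A ∈ P.parts) (hB : B ∈ P.parts) (h : A ⊆ B) : A = B := by
  obtain ⟨x, hx⟩ := P.nonempty_of_mem_parts hA
  exact P.eq_of_mem_parts hA hB hx (h hx)

theorem blocksIn_self (α : WeightedPartition n) {B : Finset (Fin n)}
    (hB : B ∈ α.partition.parts) : α.blocksIn B = {B} := by
  ext A
  rw [mem_blocksIn, Finset.mem_singleton]
  constructor
  · rintro ⟨hA, h⟩
    exact part_eq_of_subset hA hB h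
  · rintro rfl
    exact ⟨hB, subset_rfl⟩

theorem blocksIn_biUnion {α β : WeightedPartition n} (h : α.partition ≤ β.partition)
    {γ : WeightedPartition n} (h' : β.partition ≤ γ.partition) {C : Finset (Fin n)}
    (hC : C ∈ γ.partition.parts) :
    α.blocksIn C = (β.blocksIn C).biUnion α.blocksIn := by
  ext A
  simp only [mem_blocksIn, Finset.mem_biUnion]
  constructor
  · rintro ⟨hA, hAC⟩
    obtain ⟨B, hB, hAB⟩ := h hA
    obtain ⟨C', hC', hBC'⟩ := h' hB
    obtain ⟨x, hx⟩ := α.partition.nonempty_of_mem_parts hA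
    have hCC : C' = C := γ.partition.eq_of_mem_parts hC' hC (hBC' (hAB hx)) (hAC hx)
    subst hCC
    exact ⟨B, ⟨hB, hBC'⟩, hA, hAB⟩
  · rintro ⟨B, ⟨hB, hBC⟩, hA, hAB⟩
    exact ⟨hA, hAB.trans hBC⟩

theorem blocksIn_pairwiseDisjoint (α β : WeightedPartition n) (C : Finset (Fin n)) :
    ((β.blocksIn C : Finset (Finset (Fin n))) : Set (Finset (Fin n))).PairwiseDisjoint
      α.blocksIn := by
  intro B hB B' hB' hne
  refine Finset.disjoint_left.2 fun A hA hA' => hne ?_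
  rw [mem_blocksIn] at hA hA'
  obtain ⟨x, hx⟩ := α.partition.nonempty_of_mem_parts hA.1
  exact β.partition.eq_of_mem_parts (mem_blocksIn.1 hB).1 (mem_blocksIn.1 hB').1
    (hA.2 hx) (hA'.2 hx)

theorem le_trans' {α β γ : WeightedPartition n} (h₁ : α ≤ β) (h₂ : β ≤ γ) : α ≤ γ := by
  refine ⟨h₁.1.trans h₂.1, fun C hC => ?_⟩
  obtain ⟨d, hd, hw⟩ := h₂.2 C hC
  have key : ∀ B ∈ β.blocksIn C, ∃ e < (α.blocksIn B).card,
      β.weight B = (∑ A ∈ α.blocksIn B, α.weight A) + e :=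
    fun B hB => h₁.2 B (mem_blocksIn.1 hB).1
  choose! e he hwe using key
  rw [blocksIn_biUnion h₁.1 h₂.1 hC, Finset.sum_biUnion (blocksIn_pairwiseDisjoint α β C),
    Finset.card_biUnion (blocksIn_pairwiseDisjoint α β C)]
  refine ⟨(∑ B ∈ β.blocksIn C, e B) + d, ?_, ?_⟩
  · have h : ∑ B ∈ β.blocksIn C, (e B + 1) ≤ ∑ B ∈ β.blocksIn C, (α.blocksIn B).card :=
      Finset.sum_le_sum fun B hB => he B hB
    rw [Finset.sum_add_distrib, Finset.sum_const, smul_eq_mul, mul_one] at h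
    omega
  · rw [hw, Finset.sum_congr rfl hwe, Finset.sum_add_distrib, add_assoc]

theorem le_antisymm' {α β : WeightedPartition n} (h₁ : α ≤ β) (h₂ : β ≤ α) : α = β := by
  have hp : α.partition = β.partition := le_antisymm h₁.1 h₂.1
  refine WeightedPartition.ext hp (funext fun B => ?_)
  by_cases hB : B ∈ β.partition.parts
  · have hBα : B ∈ α.partition.parts := hp ▸ hB
    obtain ⟨d, hd, hw⟩ := h₁.2 B hB
    rw [blocksIn_self α hBα] at hd hw
    simp only [Finset.card_singleton, Nat.lt_one_iff, Finset.sum_singleton] at hd hw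
    omega
  · have hBα : B ∉ α.partition.parts := fun h => hB (hp ▸ h)
    rw [α.weight_eq_zero B hBα, β.weight_eq_zero B hB]

/-- The poset `Π_n^w` of weighted partitions. -/
instance : PartialOrder (WeightedPartition n) where
  le_refl α := ⟨le_rfl, fun B hB => ⟨0, by simp [blocksIn_self α hB], by
    simp [blocksIn_self α hB]⟩⟩
  le_trans _ _ _ := le_trans'
  le_antisymm _ _ := le_antisymm'

instance : Finite (WeightedPartition n) := by
  have hlt : ∀ (α : WeightedPartition n) (B : Finset (Fin n)), α.weight B < n + 1 := by
    intro α B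
    by_cases hB : B ∈ α.partition.parts
    · have h1 := α.weight_lt B hB
      have h2 : B.card ≤ n := by simpa using Finset.card_le_univ B
      omega
    · rw [α.weight_eq_zero B hB]
      omega
  refine Finite.of_injective
    (fun α : WeightedPartition n =>
      ((α.partition.parts, fun B => ⟨α.weight B, hlt α B⟩) :
        Finset (Finset (Fin n)) × (Finset (Fin n) → Fin (n + 1)))) ?_
  intro α β h
  simp only [Prod.mk.injEq] at h
  refine WeightedPartition.ext (Finpartition.ext h.1) (funext fun B => ?_)
  simpa using congrArg Fin.val (congrFun h.2 B)

noncomputable instance : DecidableEq (WeightedPartition n) := Classical.decEq _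

noncomputable instance : LocallyFiniteOrder (WeightedPartition n) :=
  LocallyFiniteOrder.ofFiniteIcc fun _ _ => Set.toFinite _

/-- The weighted partition `0̂ = {{1}^0, {2}^0, ..., {n}^0}`. -/
def zeroHat (n : ℕ) : WeightedPartition n where
  partition := ⊥
  weight _ := 0
  weight_lt _ hB := Finset.card_pos.2 (Finpartition.nonempty_of_mem_parts _ hB)
  weight_eq_zero _ _ := rfl

/-- The weighted partition `[n]^i` whose only block is `[n]`, with weight `i`. -/
def single (n i : ℕ) (hi : i < n) : WeightedPartition n where
  partition := Finpartition.indiscrete (a := (Finset.univ : Finset (Fin n)))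
    (Finset.nonempty_iff_ne_empty.1 ⟨⟨i, hi⟩, Finset.mem_univ _⟩)
  weight B := if B = Finset.univ then i else 0
  weight_lt B hB := by
    rw [Finpartition.indiscrete_parts, Finset.mem_singleton] at hB
    simpa [hB] using hi
  weight_eq_zero B hB := by
    rw [Finpartition.indiscrete_parts, Finset.mem_singleton] at hB
    simp [hB]

end WeightedPartition

/-- A rooted tree on the node set `[n]` (modelled by `Fin n`): a tree with a distinguished node. -/
structure LabeledRootedTree (n : ℕ) where
  graph : SimpleGraph (Fin n)
  isTree : graph.IsTree
  root : Fin n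

namespace LabeledRootedTree

variable {n : ℕ}

/-- `p` is the parent of `x`: the neighbour of `x` that is one step closer to the root. -/
def IsParent (T : LabeledRootedTree n) (p x : Fin n) : Prop :=
  T.graph.Adj x p ∧ T.graph.dist x T.root = T.graph.dist p T.root + 1

/-- The descents of `T`: the nodes whose label is smaller than that of their parent. -/
def descents (T : LabeledRootedTree n) : Set (Fin n) :=
  {x | ∃ p, T.IsParent p x ∧ x < p}

/-- The set of rooted trees on node set `[n]` with exactly `i` descents. -/
def withDescents (n i : ℕ) : Set (LabeledRootedTree n) :=
  {T | T.descents.ncard = i}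

instance : Finite (LabeledRootedTree n) := by
  refine Finite.of_injective
    (fun T : LabeledRootedTree n => ((T.graph, T.root) : SimpleGraph (Fin n) × Fin n)) ?_
  rintro ⟨G, hG, r⟩ ⟨G', hG', r'⟩ h
  simp only [Prod.mk.injEq] at h
  obtain ⟨rfl, rfl⟩ := h
  rfl

end LabeledRootedTree

/-! Rooted forests on `[n]` are encoded by parent maps `p` whose fixed points are the roots. Each
forest gives a weighted partition `ofForest p`: its blocks are the trees, weighted by their numbers
of descents. The claim proved is more general than the theorem: `μ(0̂, β)` is the sum of `(-1) ^ (n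
+ #roots)` over the forests with `ofForest p = β` (`mu_zeroHat`). For `β = [n]^i` these forests are
the trees with `i` descents, each with one root.

By the recursion that defines `μ`, it suffices that the signed count of forests with `ofForest p ≤
β` is `1` at `β = 0̂` and `0` elsewhere (`sum_ofForest_le`). Being below `β` is a condition on each
block separately: a block `C` of weight `v` is closed under `p` and satisfies `desc ≤ v < desc +
roots` (`ofForest_le_iff`). So one block with at least two elements must contribute `0`, that is,
`desc ≤ v` and `desc + roots ≤ v` must have the same signed count (`sum_forest_descents_eq`).

Both counts are reduced by sign-reversing involutions that turn a root into a child of a fixed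
vertex `z`, or back. With `z = min C` this preserves `desc`; with `z = max C` it trades a root for a
descent and preserves `desc + roots`. What survives are the trees on `C` in which `z` is a leaf,
with `desc ≤ v` and `desc + 1 ≤ v` respectively. Relabelling the minimum as the maximum and shifting
the other labels down matches them: the leaf stops being a descent and nothing else changes. -/

/-- The orbit of `x` under `p` ends in a fixed point of `p`. -/
inductive EventuallyFixed {V : Type*} (p : V → V) : V → Prop
  | fixed (x : V) : p x = x → EventuallyFixed p x
  | step (x : V) : EventuallyFixed p (p x) → EventuallyFixed p x

/-- `x` lies on the orbit of `z` under `p`. -/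
def InOrbit {V : Type*} (p : V → V) (z x : V) : Prop := ∃ k : ℕ, p^[k] z = x

/-- The map `p` is the parent map of a rooted forest whose roots are the fixed points of `p`. -/
def IsForest {V : Type*} (p : V → V) : Prop := ∀ x, EventuallyFixed p x

/-! ### Parent maps of forests, their orbits, and surgery at one vertex. -/

section Orbits

variable {V : Type*} {p : V → V}

theorem InOrbit.refl (z : V) : InOrbit p z z := ⟨0, rfl⟩

theorem InOrbit.step {z x : V} (h : InOrbit p z x) : InOrbit p z (p x) := by
  obtain ⟨k, rfl⟩ := h
  exact ⟨k + 1, Function.iterate_succ_apply' p k z⟩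

theorem InOrbit.of_apply {z x : V} (h : InOrbit p (p z) x) : InOrbit p z x := by
  obtain ⟨k, rfl⟩ := h
  exact ⟨k + 1, Function.iterate_succ_apply p k z⟩

theorem InOrbit.eq_of_fixed {z x : V} (hz : p z = z) (h : InOrbit p z x) : x = z := by
  obtain ⟨k, rfl⟩ := h
  exact Function.iterate_fixed hz k

theorem InOrbit.apply_of_ne {z x : V} (h : InOrbit p z x) (hne : x ≠ z) : InOrbit p (p z) x := by
  obtain ⟨k, rfl⟩ := h
  cases k with
  | zero => exact absurd rfl hne
  | succ k => exact ⟨k, (Function.iterate_succ_apply p k z).symm⟩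

theorem InOrbit.mem {z x : V} (h : InOrbit p z x) {S : Set V} (hS : ∀ y ∈ S, p y ∈ S)
    (hz : z ∈ S) : x ∈ S := by
  obtain ⟨k, rfl⟩ := h
  induction k with
  | zero => exact hz
  | succ k ih => rw [Function.iterate_succ_apply']; exact hS _ ih

theorem InOrbit.trans {x y z : V} (h : InOrbit p x y) (h' : InOrbit p y z) : InOrbit p x z :=
  h'.mem (S := {w | InOrbit p x w}) (fun _ hw => InOrbit.step hw) h

theorem InOrbit.eq_of_fixed_fixed {z x y : V} (hz : InOrbit p z x) (hy : InOrbit p z y)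
    (hx : p x = x) (hyf : p y = y) : x = y := by
  obtain ⟨k, rfl⟩ := hz
  obtain ⟨l, rfl⟩ := hy
  rcases le_total k l with h | h <;> obtain ⟨d, rfl⟩ := Nat.exists_eq_add_of_le h
  · rw [add_comm, Function.iterate_add_apply, Function.iterate_fixed hx]
  · rw [add_comm, Function.iterate_add_apply, Function.iterate_fixed hyf]

theorem EventuallyFixed.exists_root {x : V} (h : EventuallyFixed p x) :
    ∃ r, InOrbit p x r ∧ p r = r := by
  induction h with
  | fixed x h => exact ⟨x, .refl x, h⟩
  | step x _ ih =>
    obtain ⟨r, hr, hf⟩ := ih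
    exact ⟨r, hr.of_apply, hf⟩

/-- In a forest no two distinct vertices lie on each other's orbit. -/
theorem EventuallyFixed.eq_of_inOrbit {x y : V} (h : EventuallyFixed p x) (hxy : InOrbit p x y)
    (hyx : InOrbit p y x) : x = y := by
  obtain ⟨r, hr, hf⟩ := h.exists_root
  by_contra hne
  -- The vertices whose orbit reaches `x` are closed under `p`: from `x` itself one returns by way
  -- of `y`. So the root reaches `x`, and `x` is the root.
  have hS : r ∈ {w | InOrbit p w x} := by
    refine hr.mem (fun w hw => ?_) (.refl x)
    by_cases hwx : x = w
    · subst hwx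
      exact (hxy.apply_of_ne (Ne.symm hne)).trans hyx
    · exact InOrbit.apply_of_ne hw hwx
  have hxr : x = r := InOrbit.eq_of_fixed hf hS
  subst hxr
  exact hne (hxy.eq_of_fixed hf).symm

theorem InOrbit.update [DecidableEq V] {x z y w : V} (hx : ¬ InOrbit p z x)
    (h : InOrbit p z y) : InOrbit (Function.update p x w) z y := by
  have : y ∈ {y | InOrbit (Function.update p x w) z y ∧ InOrbit p z y} := by
    refine h.mem (fun y hy => ?_) ⟨.refl z, .refl z⟩
    refine ⟨?_, hy.2.step⟩
    have hyx : y ≠ x := fun h => hx (h ▸ hy.2)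
    have := hy.1.step
    rwa [Function.update_of_ne hyx] at this
  exact this.1

theorem inOrbit_update_iff [DecidableEq V] {x z w : V} (hx : ¬ InOrbit p z x) (y : V) :
    InOrbit (Function.update p x w) z y ↔ InOrbit p z y := by
  refine ⟨fun h => ?_, fun h => h.update hx⟩
  refine h.mem (S := {y | InOrbit p z y}) (fun y hy => ?_) (.refl z)
  have hyx : y ≠ x := fun h => hx (h ▸ hy)
  rw [Function.update_of_ne hyx]
  exact InOrbit.step hy

theorem EventuallyFixed.of_inOrbit {x y : V} (hxy : InOrbit p x y) (h : EventuallyFixed p y) :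
    EventuallyFixed p x := by
  obtain ⟨k, rfl⟩ := hxy
  induction k generalizing x with
  | zero => exact h
  | succ k ih => exact .step _ (ih h)

theorem IsForest.update_self [DecidableEq V] (hp : IsForest p) (x : V) :
    IsForest (Function.update p x x) := by
  intro y
  induction hp y with
  | fixed y h =>
    refine .fixed y ?_
    by_cases hy : y = x
    · subst hy; simp
    · simp [hy, h]
  | step y _ ih =>
    by_cases hy : y = x
    · subst hy; exact .fixed _ (by simp)
    · exact .step _ (by simpa [hy] using ih)

/-- Hanging `x` below `z` creates no cycle, because the path from `z` to its root avoids `x` and is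
left untouched. -/
theorem IsForest.update_of_not_inOrbit [DecidableEq V] (hp : IsForest p) {x z : V}
    (hx : ¬ InOrbit p z x) : IsForest (Function.update p x z) := by
  have hz : EventuallyFixed (Function.update p x z) z := by
    obtain ⟨r, hr, hf⟩ := (hp z).exists_root
    refine .of_inOrbit (hr.update hx) (.fixed r ?_)
    have hrx : r ≠ x := fun h => hx (h ▸ hr)
    rw [Function.update_of_ne hrx, hf]
  have hx' : EventuallyFixed (Function.update p x z) x := .step _ (by simpa using hz)
  intro y
  induction hp y with
  | fixed y h =>
    by_cases hy : y = x
    · exact hy ▸ hx'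
    · exact .fixed _ (by simp [hy, h])
  | step y _ ih =>
    by_cases hy : y = x
    · exact hy ▸ hx'
    · exact .step _ (by simpa [hy] using ih)

theorem InOrbit.conj {x z : V} (σ : Equiv.Perm V) (h : InOrbit p z x) :
    InOrbit (σ ∘ p ∘ σ.symm) (σ z) (σ x) := by
  refine h.mem (S := {x | InOrbit (σ ∘ p ∘ σ.symm) (σ z) (σ x)}) (fun y hy => ?_) (.refl _)
  simpa using InOrbit.step hy

theorem inOrbit_conj_iff {x z : V} (σ : Equiv.Perm V) :
    InOrbit (σ ∘ p ∘ σ.symm) (σ z) (σ x) ↔ InOrbit p z x := by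
  refine ⟨fun h => ?_, .conj σ⟩
  have := h.conj σ.symm
  simpa [Function.comp_def] using this

theorem IsForest.conj (hp : IsForest p) (σ : Equiv.Perm V) : IsForest (σ ∘ p ∘ σ.symm) := by
  intro y
  obtain ⟨x, rfl⟩ := σ.surjective y
  induction hp x with
  | fixed x h => exact .fixed _ (by simp [h])
  | step x _ ih => exact .step _ (by simpa using ih)

theorem IsForest.of_conj (σ : Equiv.Perm V) (hp : IsForest (σ ∘ p ∘ σ.symm)) : IsForest p := by
  simpa [Function.comp_def] using hp.conj σ.symm

end Orbits

/-! ### The sign-reversing involution at a vertex `z`. -/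

section Toggle

open Finset

variable {V : Type*} [DecidableEq V]

/-- The vertices of `C` that are a root or a child of `z`, and that are not above `z`. -/
noncomputable def movable (C : Finset V) (z : V) (p : V → V) : Finset V :=
  open Classical in C.filter fun x => ¬ InOrbit p z x ∧ (p x = z ∨ p x = x)

theorem mem_movable {C : Finset V} {z x : V} {p : V → V} :
    x ∈ movable C z p ↔ x ∈ C ∧ ¬ InOrbit p z x ∧ (p x = z ∨ p x = x) := by
  simp [movable]

/-- Make `x` a root if it is a child of `z`, and a child of `z` otherwise. -/
def toggle (z x : V) (p : V → V) : V → V :=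
  Function.update p x (if p x = z then x else z)

/-- The orbit of `z` avoids `x`, so it does not see the change at `x`. This invariance makes a
canonical choice of movable vertex an involution. -/
theorem movable_toggle {C : Finset V} {z x : V} {p : V → V} (hx : x ∈ movable C z p) :
    movable C z (toggle z x p) = movable C z p := by
  rw [mem_movable] at hx
  ext y
  rw [mem_movable, mem_movable, toggle, inOrbit_update_iff hx.2.1]
  by_cases hy : y = x
  · subst hy
    simp only [Function.update_self, hx.2.2, hx.1, hx.2.1, true_and, not_false_eq_true, iff_true]
    split_ifs <;> simp
  · rw [Function.update_of_ne hy]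

theorem toggle_toggle {C : Finset V} {z x : V} {p : V → V} (hx : x ∈ movable C z p) :
    toggle z x (toggle z x p) = p := by
  rw [mem_movable] at hx
  have hxz : x ≠ z := fun h => hx.2.1 (h ▸ .refl _)
  ext y
  by_cases hy : y = x
  · subst hy
    rcases hx.2.2 with h | h <;> simp [toggle, h, hxz]
  · simp [toggle, hy]

theorem IsForest.toggle {C : Finset V} {z x : V} {p : V → V} (hp : IsForest p)
    (hx : x ∈ movable C z p) : IsForest (toggle z x p) := by
  rw [mem_movable] at hx
  unfold _root_.toggle
  split_ifs
  · exact hp.update_self x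
  · exact hp.update_of_not_inOrbit hx.2.1

/-- The roots in `C`. -/
def rootsIn (C : Finset V) (p : V → V) : Finset V := C.filter fun x => p x = x

theorem mem_rootsIn {C : Finset V} {p : V → V} {x : V} : x ∈ rootsIn C p ↔ x ∈ C ∧ p x = x :=
  mem_filter

/-- The descents in `C`. -/
def descentsIn {V : Type*} [LinearOrder V] (C : Finset V) (p : V → V) : Finset V :=
  C.filter fun x => x < p x

theorem mem_descentsIn {V : Type*} [LinearOrder V] {C : Finset V} {p : V → V} {x : V} :
    x ∈ descentsIn C p ↔ x ∈ C ∧ x < p x :=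
  mem_filter

theorem card_rootsIn_toggle {C : Finset V} {z x : V} {p : V → V} (hx : x ∈ movable C z p) :
    (p x = z ∧ (rootsIn C (toggle z x p)).card = (rootsIn C p).card + 1) ∨
      (p x = x ∧ (rootsIn C p).card = (rootsIn C (toggle z x p)).card + 1) := by
  have hx' := mem_movable.1 hx
  have hxz : x ≠ z := fun h => hx'.2.1 (h ▸ .refl _)
  rcases hx'.2.2 with h | h
  · left
    refine ⟨h, ?_⟩
    have hi : rootsIn C (toggle z x p) = insert x (rootsIn C p) := by
      ext y
      by_cases hy : y = x
      · subst hy; simp [mem_rootsIn, toggle, h, hx'.1]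
      · simp [mem_rootsIn, toggle, hy]
    rw [hi, card_insert_of_notMem]
    simp [mem_rootsIn, h, hxz.symm]
  · right
    refine ⟨h, ?_⟩
    have hi : rootsIn C p = insert x (rootsIn C (toggle z x p)) := by
      ext y
      by_cases hy : y = x
      · subst hy; simp [mem_rootsIn, h, hx'.1]
      · simp [mem_rootsIn, toggle, hy]
    rw [hi, card_insert_of_notMem]
    simp [mem_rootsIn, toggle, h, hxz, hxz.symm]

/-- The signed sum over forests is unchanged when it is restricted to the forests without a
movable vertex. -/
theorem sum_forest_eq_sum_movable_empty {V : Type*} [LinearOrder V] {C : Finset V} {z : V}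
    {F : Finset (V → V)} {g : (V → V) → ℤ}
    (hFt : ∀ p ∈ F, ∀ x ∈ movable C z p, toggle z x p ∈ F)
    (hg : ∀ p ∈ F, ∀ x ∈ movable C z p, g (toggle z x p) = g p) :
    ∑ p ∈ F, (-1 : ℤ) ^ (rootsIn C p).card * g p =
      ∑ p ∈ F with movable C z p = ∅, (-1 : ℤ) ^ (rootsIn C p).card * g p := by
  rw [← sum_filter_add_sum_filter_not _ (fun p => movable C z p = ∅), add_eq_left]
  have hmem : ∀ p : V → V, p ∈ filter (fun p => ¬ movable C z p = ∅) F →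
      p ∈ F ∧ (movable C z p).Nonempty := by
    intro p hp
    simpa [nonempty_iff_ne_empty] using hp
  -- Toggling the least movable vertex is an involution because the movable set does not change; it
  -- alters the number of roots by one, hence the sign.
  refine sum_involution (fun p hp => toggle z ((movable C z p).min' (hmem p hp).2) p) ?_ ?_ ?_ ?_
  · intro p hp
    have hx := (movable C z p).min'_mem (hmem p hp).2
    rw [hg p (hmem p hp).1 _ hx]
    rcases card_rootsIn_toggle hx with h | h
    · rw [h.2]; ring
    · rw [h.2]; ring
  · intro p hp _ h
    have hx := (movable C z p).min'_mem (hmem p hp).2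
    have := card_rootsIn_toggle hx
    rw [h] at this
    omega
  · intro p hp
    have hx := (movable C z p).min'_mem (hmem p hp).2
    refine mem_filter.2 ⟨hFt p (hmem p hp).1 _ hx, ?_⟩
    rw [movable_toggle hx]
    exact (hmem p hp).2.ne_empty
  · intro p hp
    have hx := (movable C z p).min'_mem (hmem p hp).2
    simp only [movable_toggle hx]
    exact toggle_toggle hx

end Toggle

/-! ### Cancellation on a single block. -/

section Cancellation

open Finset

variable {V : Type*} [LinearOrder V]

/-- A forest without movable vertices is a tree on `C` in which `z` is a leaf. -/
theorem tree_of_movable_eq_empty {C : Finset V} {z : V} {p : V → V} (hp : IsForest p)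
    (hC : ∀ x, p x ∈ C ↔ x ∈ C) (hz : z ∈ C) (hcard : 1 < C.card) (hm : movable C z p = ∅) :
    (rootsIn C p).card = 1 ∧ ∀ x ∈ C, p x ≠ z := by
  have key : ∀ x ∈ C, p x = z ∨ p x = x → InOrbit p z x := by
    intro x hx h
    by_contra hn
    exact notMem_empty x (hm ▸ mem_movable.2 ⟨hx, hn, h⟩)
  have hleaf : ∀ x ∈ C, x ≠ z → p x ≠ z := by
    intro x hx hne h
    have h1 : InOrbit p x z := h ▸ (InOrbit.refl x).step
    exact hne ((hp x).eq_of_inOrbit h1 (key x hx (.inl h)))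
  -- If `z` were a root, its orbit would be `{z}`, so `C` would have no other root and no child of
  -- `z`. Any other vertex of `C` would then have a path that never ends.
  have hzz : p z ≠ z := by
    intro hf
    have hno : ∀ y ∈ C, y ≠ z → False := by
      intro y
      induction hp y with
      | fixed y h => exact fun hy hne => hne ((key y hy (.inr h)).eq_of_fixed hf)
      | step y _ ih => exact fun hy hne => ih ((hC y).2 hy) (hleaf y hy hne)
    obtain ⟨y, hy, hne⟩ := exists_mem_ne hcard z
    exact hno y hy hne
  constructor
  · obtain ⟨r, hr, hf⟩ := (hp z).exists_root
    have hrC : r ∈ C := hr.mem (S := (C : Set V)) (fun y hy => (hC y).2 hy) hz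
    refine card_eq_one.2 ⟨r, ?_⟩
    ext x
    rw [mem_rootsIn, mem_singleton]
    constructor
    · rintro ⟨hx, hxf⟩
      exact (key x hx (.inr hxf)).eq_of_fixed_fixed hr hxf hf
    · rintro rfl
      exact ⟨hrC, hf⟩
  · intro x hx
    by_cases hxz : x = z
    · exact hxz ▸ hzz
    · exact hleaf x hx hxz

/-- The permutation that sends the minimum of `C` to its maximum and every other element of `C`
to its predecessor in `C`. -/
theorem exists_shift {C : Finset V} (hC : C.Nonempty) :
    ∃ (σ : Equiv.Perm V) (a b : V), a ∈ C ∧ b ∈ C ∧ (∀ x ∈ C, a ≤ x) ∧ (∀ x ∈ C, x ≤ b) ∧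
      (∀ x ∉ C, σ x = x) ∧ (∀ x, σ x ∈ C ↔ x ∈ C) ∧ σ a = b ∧
      ∀ x ∈ C, ∀ y ∈ C, x ≠ a → y ≠ a → (σ x < σ y ↔ x < y) := by
  obtain ⟨k, hk⟩ : ∃ k, C.card = k + 1 := ⟨C.card - 1, by have := hC.card_pos; omega⟩
  let e : Fin (k + 1) ≃o C := C.orderIsoOfFin hk
  let τ : Equiv.Perm (Fin (k + 1)) := (finRotate (k + 1)).symm
  let σ : Equiv.Perm V := Equiv.Perm.ofSubtype ((e.symm.toEquiv.trans τ).trans e.toEquiv)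
  have hσ : ∀ i : Fin (k + 1), σ (e i) = e (τ i) := by
    intro i
    simp [σ]
  have hσn : ∀ x ∉ C, σ x = x := fun x hx => Equiv.Perm.ofSubtype_apply_of_not_mem _ hx
  have hrep : ∀ x ∈ C, ∃ i, x = e i := fun x hx => ⟨e.symm ⟨x, hx⟩, by simp⟩
  have hσC : ∀ x ∈ C, σ x ∈ C := by
    intro x hx
    obtain ⟨i, rfl⟩ := hrep x hx
    rw [hσ]
    exact (e (τ i)).2
  have hτ0 : τ 0 = Fin.last k := by
    rw [Equiv.symm_apply_eq, finRotate_last]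
  have hτs : ∀ i : Fin k, τ i.succ = i.castSucc := by
    intro i
    rw [Equiv.symm_apply_eq, finRotate_apply, Fin.coeSucc_eq_succ]
  refine ⟨σ, e 0, e (Fin.last k), (e 0).2, (e _).2, ?_, ?_, hσn, fun x => ⟨fun h => ?_, hσC x⟩,
    ?_, ?_⟩
  · intro x hx
    obtain ⟨i, rfl⟩ := hrep x hx
    exact e.monotone (Fin.zero_le i)
  · intro x hx
    obtain ⟨i, rfl⟩ := hrep x hx
    exact e.monotone (Fin.le_last i)
  · by_contra hx
    exact hx (hσn x hx ▸ h)
  · rw [hσ, hτ0]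
  · intro x hx y hy hxa hya
    obtain ⟨i, rfl⟩ := hrep x hx
    obtain ⟨j, rfl⟩ := hrep y hy
    obtain ⟨i, rfl⟩ := Fin.exists_succ_eq.2 (fun h : i = 0 => hxa (by rw [h]))
    obtain ⟨j, rfl⟩ := Fin.exists_succ_eq.2 (fun h : j = 0 => hya (by rw [h]))
    rw [hσ, hσ, hτs, hτs, Subtype.coe_lt_coe, Subtype.coe_lt_coe, e.lt_iff_lt, e.lt_iff_lt]
    simp

/-- Toggling at the minimum of `C` and at its maximum reduces both signed sums to trees on `C`, which
`exists_shift` matches. -/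
theorem sum_forest_descents_eq {C : Finset V} (hcard : 1 < C.card) {v : ℕ} {g : (V → V) → ℤ}
    (hg : ∀ p q : V → V, (∀ x ∉ C, p x = q x) → g p = g q) {F G : Finset (V → V)}
    (hF : ∀ p, p ∈ F ↔ IsForest p ∧ (∀ x, p x ∈ C ↔ x ∈ C) ∧ (descentsIn C p).card ≤ v)
    (hG : ∀ p, p ∈ G ↔ IsForest p ∧ (∀ x, p x ∈ C ↔ x ∈ C) ∧
      (descentsIn C p).card + (rootsIn C p).card ≤ v) :
    ∑ p ∈ F, (-1 : ℤ) ^ (rootsIn C p).card * g p =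
      ∑ p ∈ G, (-1 : ℤ) ^ (rootsIn C p).card * g p := by
  obtain ⟨σ, a, b, ha, hb, hmin, hmax, hσn, hσC, hσa, hσlt⟩ :=
    exists_shift (card_pos.1 (zero_lt_one.trans hcard))
  have hinv : ∀ z ∈ C, ∀ p : V → V, (∀ x, p x ∈ C ↔ x ∈ C) → ∀ x ∈ movable C z p,
      ∀ y, toggle z x p y ∈ C ↔ y ∈ C := by
    intro z hz p hp x hx y
    have hxC := (mem_movable.1 hx).1
    by_cases hy : y = x
    · subst hy
      simp only [toggle, Function.update_self, hxC, iff_true]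
      split_ifs <;> assumption
    · simp [toggle, hy, hp y]
  have hgt : ∀ z, ∀ p : V → V, ∀ x ∈ movable C z p, g (toggle z x p) = g p := by
    intro z p x hx
    refine hg _ _ fun y hy => ?_
    have hyx : y ≠ x := fun h => hy (h ▸ (mem_movable.1 hx).1)
    simp [toggle, hyx]
  rw [sum_forest_eq_sum_movable_empty (F := F) (z := a) ?_
    fun p _ x hx => hgt a p x hx, sum_forest_eq_sum_movable_empty (F := G) (z := b) ?_
    fun p _ x hx => hgt b p x hx]
  rotate_left
  -- At the maximum `b`, a child of `b` is a descent and a root is not, so the toggle preserves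
  -- `desc + roots`.
  · intro p hp x hx
    obtain ⟨hpF, hpC, hv⟩ := (hG p).1 hp
    refine (hG _).2 ⟨hpF.toggle hx, hinv b hb p hpC x hx, ?_⟩
    have hx' := mem_movable.1 hx
    have hxb : x < b := lt_of_le_of_ne (hmax x hx'.1) fun h => hx'.2.1 (h ▸ .refl _)
    rcases card_rootsIn_toggle hx with ⟨h, hr⟩ | ⟨h, hr⟩
    · have : descentsIn C p = insert x (descentsIn C (toggle b x p)) := by
        ext y
        by_cases hy : y = x
        · subst hy; simp [mem_descentsIn, h, hx'.1, hxb]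
        · simp [mem_descentsIn, toggle, hy]
      rw [this, card_insert_of_notMem (by simp [mem_descentsIn, toggle, h])] at hv
      omega
    · have hxx : ¬ x = b := hxb.ne
      have : descentsIn C (toggle b x p) = insert x (descentsIn C p) := by
        ext y
        by_cases hy : y = x
        · subst hy; simp [mem_descentsIn, toggle, h, hx'.1, hxb, hxx]
        · simp [mem_descentsIn, toggle, hy]
      rw [this, card_insert_of_notMem (by simp [mem_descentsIn, h])]
      omega
  -- At the minimum `a`, neither a child of `a` nor a root is a descent, so the toggle preserves
  -- `desc`.
  · intro p hp x hx
    obtain ⟨hpF, hpC, hv⟩ := (hF p).1 hp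
    refine (hF _).2 ⟨hpF.toggle hx, hinv a ha p hpC x hx, ?_⟩
    have hx' := mem_movable.1 hx
    have hax : a ≤ x := hmin x hx'.1
    have : descentsIn C (toggle a x p) = descentsIn C p := by
      ext y
      by_cases hy : y = x
      · subst hy
        have h1 : ¬ y < p y := by
          rcases hx'.2.2 with h | h <;> rw [h] <;> simp [hax]
        have h2 : ¬ y < toggle a y p y := by
          simp only [toggle, Function.update_self]
          split_ifs <;> simp [hax]
        simp [mem_descentsIn, h1, h2]
      · simp [mem_descentsIn, toggle, hy]
    rwa [this]
  have hsymm : ∀ x, σ.symm x ∈ C ↔ x ∈ C := fun x => by rw [← hσC (σ.symm x), σ.apply_symm_apply]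
  have hroots : ∀ p : V → V, (rootsIn C (σ ∘ p ∘ σ.symm)).card = (rootsIn C p).card := by
    intro p
    rw [← card_map σ.toEmbedding (s := rootsIn C p)]
    congr 1
    ext x
    simp [mem_rootsIn, mem_map_equiv, hsymm, Equiv.eq_symm_apply]
  have hinvσ : ∀ p : V → V, (∀ x, (σ ∘ p ∘ σ.symm) x ∈ C ↔ x ∈ C) ↔ ∀ x, p x ∈ C ↔ x ∈ C := by
    intro p
    rw [← σ.forall_congr_right]
    simp [hσC]
  have hmov : ∀ p : V → V, movable C b (σ ∘ p ∘ σ.symm) = (movable C a p).map σ.toEmbedding := by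
    intro p
    ext x
    obtain ⟨x, rfl⟩ := σ.surjective x
    simp only [mem_map_equiv, mem_movable, ← hσa, inOrbit_conj_iff, hσC]
    simp
  refine sum_equiv σ.conj (fun p => ?_) (fun p hp => ?_)
  · simp only [mem_filter, hF, hG]
    change _ ↔ (IsForest (σ ∘ p ∘ σ.symm) ∧ (∀ x, (σ ∘ p ∘ σ.symm) x ∈ C ↔ x ∈ C) ∧
      (descentsIn C (σ ∘ p ∘ σ.symm)).card + (rootsIn C (σ ∘ p ∘ σ.symm)).card ≤ v) ∧
      movable C b (σ ∘ p ∘ σ.symm) = ∅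
    rw [hmov, map_eq_empty, hroots, hinvσ]
    have hfor : IsForest (σ ∘ p ∘ σ.symm) ↔ IsForest p := ⟨.of_conj σ, fun h => h.conj σ⟩
    rw [hfor]
    refine and_congr_left fun hm => and_congr_right fun hp => and_congr_right fun hpC => ?_
    obtain ⟨hr, hl⟩ := tree_of_movable_eq_empty hp hpC ha hcard hm
    -- The non-root `a` is a descent, being the minimum, while its image `b` is not, being the
    -- maximum. As `a` is a leaf, every other comparison with a parent avoids `a`, where `σ`
    -- preserves the order.
    have hd : descentsIn C p = insert a ((descentsIn C (σ ∘ p ∘ σ.symm)).map σ.symm.toEmbedding) := by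
      ext x
      simp only [mem_insert, mem_map_equiv, mem_descentsIn, Equiv.symm_symm, Function.comp_apply,
        Equiv.symm_apply_apply, hσC]
      by_cases hxa : x = a
      · subst hxa
        simp only [true_or, iff_true, ha, true_and]
        exact lt_of_le_of_ne (hmin _ ((hpC _).2 ha)) (hl _ ha).symm
      · simp only [hxa, false_or]
        refine and_congr_right fun hx => (hσlt x hx _ ((hpC x).2 hx) hxa (hl x hx)).symm
    have hσb : σ.symm b = a := by rw [← hσa, σ.symm_apply_apply]
    rw [hd, card_insert_of_notMem, card_map, hr]
    simp only [mem_map_equiv, mem_descentsIn, Equiv.symm_symm, Function.comp_apply, hσa, hσb]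
    exact fun h => (hmax _ ((hσC _).2 ((hpC _).2 ha))).not_gt h.2
  · change _ = (-1 : ℤ) ^ (rootsIn C (σ ∘ p ∘ σ.symm)).card * g (σ ∘ p ∘ σ.symm)
    rw [hroots]
    congr 1
    refine hg _ _ fun x hx => ?_
    have hσx : σ.symm x = x := by rw [Equiv.symm_apply_eq, hσn x hx]
    have hpx : p x ∉ C := fun h => hx ((((hF p).1 (mem_filter.1 hp).1).2.1 x).1 h)
    simp [hσx, hσn _ hpx]

/-- The signed sum over the forests on `C` with at most `v` descents, and fewer than `|C| - v` other
non-roots, vanishes when `C` has at least two elements. -/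
theorem sum_forest_eq_zero {C : Finset V} (hcard : 1 < C.card) {v : ℕ} {g : (V → V) → ℤ}
    (hg : ∀ p q : V → V, (∀ x ∉ C, p x = q x) → g p = g q) [Finite V] {F : Finset (V → V)}
    (hF : ∀ p, p ∈ F ↔ IsForest p ∧ (∀ x, p x ∈ C ↔ x ∈ C) ∧
      (descentsIn C p).card ≤ v ∧ v < (descentsIn C p).card + (rootsIn C p).card) :
    ∑ p ∈ F, (-1 : ℤ) ^ (rootsIn C p).card * g p = 0 := by
  classical
  cases nonempty_fintype V
  let A : Finset (V → V) := univ.filter fun p =>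
    IsForest p ∧ (∀ x, p x ∈ C ↔ x ∈ C) ∧ (descentsIn C p).card ≤ v
  let B : Finset (V → V) := univ.filter fun p =>
    IsForest p ∧ (∀ x, p x ∈ C ↔ x ∈ C) ∧ (descentsIn C p).card + (rootsIn C p).card ≤ v
  have hAB := sum_forest_descents_eq hcard hg (F := A) (G := B) (v := v)
    (by simp [A]) (by simp [B])
  have hBA : B ⊆ A := by
    intro p hp
    simp only [A, B, mem_filter, mem_univ, true_and] at hp ⊢
    exact ⟨hp.1, hp.2.1, by omega⟩
  -- The condition `desc ≤ v < desc + roots` is the first bound without the second.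
  have hFA : F = A \ B := by
    ext p
    simp only [A, B, mem_sdiff, mem_filter, mem_univ, true_and, hF]
    constructor
    · rintro ⟨h1, h2, h3, h4⟩
      exact ⟨⟨h1, h2, h3⟩, fun h => by omega⟩
    · rintro ⟨⟨h1, h2, h3⟩, h4⟩
      exact ⟨h1, h2, h3, not_le.1 fun h => h4 ⟨h1, h2, h⟩⟩
  rw [← sum_sdiff hBA, ← hFA] at hAB
  linarith

end Cancellation

/-! ### Roots and components of a forest. -/

section Roots

open Finset

variable {V : Type*}

/-- The root of the tree of the forest `p` that contains `x`. -/
noncomputable def rootOf (p : {p : V → V // IsForest p}) (x : V) : V :=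
  (p.2 x).exists_root.choose

variable (p : {p : V → V // IsForest p})

theorem inOrbit_rootOf (x : V) : InOrbit p.1 x (rootOf p x) :=
  (p.2 x).exists_root.choose_spec.1

theorem apply_rootOf (x : V) : p.1 (rootOf p x) = rootOf p x :=
  (p.2 x).exists_root.choose_spec.2

theorem rootOf_eq {x r : V} (h : InOrbit p.1 x r) (hr : p.1 r = r) : rootOf p x = r :=
  (inOrbit_rootOf p x).eq_of_fixed_fixed h (apply_rootOf p x) hr

theorem rootOf_apply (x : V) : rootOf p (p.1 x) = rootOf p x :=
  (rootOf_eq p (inOrbit_rootOf p (p.1 x)).of_apply (apply_rootOf p _)).symm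

theorem rootOf_root {r : V} (hr : p.1 r = r) : rootOf p r = r :=
  rootOf_eq p (.refl r) hr

theorem rootOf_mem_iff {D : Finset V} (hD : ∀ x, p.1 x ∈ D ↔ x ∈ D) (x : V) :
    rootOf p x ∈ D ↔ x ∈ D := by
  constructor
  · intro h
    by_contra hx
    exact (inOrbit_rootOf p x).mem (S := {y | y ∉ D}) (fun y hy h => hy ((hD y).1 h)) hx h
  · exact fun h => (inOrbit_rootOf p x).mem (S := {y | y ∈ D}) (fun y hy => (hD y).2 hy) h

variable [DecidableEq V] [Fintype V]

/-- The vertex set of the tree with root `r`. -/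
noncomputable def component (r : V) : Finset V := univ.filter fun x => rootOf p x = r

theorem mem_component {r x : V} : x ∈ component p r ↔ rootOf p x = r := by
  simp [component]

end Roots

/-! ### The weighted partition of a forest and the Möbius function. -/

namespace WeightedPartition

open Finset

variable {n : ℕ} (p : {p : Fin n → Fin n // IsForest p})

/-- The partition of `[n]` into the vertex sets of the trees of a forest. -/
noncomputable def treePartition : Finpartition (univ : Finset (Fin n)) :=
  open Classical in
  Finpartition.ofSetoid (Setoid.ker (rootOf p))

theorem mem_part_treePartition {x y : Fin n} :
    y ∈ (treePartition p).part x ↔ rootOf p y = rootOf p x := by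
  classical
  rw [treePartition, Finpartition.mem_part_ofSetoid_iff_rel]
  exact eq_comm

theorem parts_treePartition :
    (treePartition p).parts = (rootsIn univ p.1).image (component p) := by
  ext B
  constructor
  · intro hB
    obtain ⟨x, hx⟩ := (treePartition p).nonempty_of_mem_parts hB
    refine mem_image.2 ⟨rootOf p x, mem_rootsIn.2 ⟨mem_univ _, apply_rootOf p x⟩, ?_⟩
    rw [← (treePartition p).part_eq_of_mem hB hx]
    ext y
    rw [mem_component, mem_part_treePartition]
  · intro hB
    obtain ⟨r, hr, rfl⟩ := mem_image.1 hB
    have : component p r = (treePartition p).part r := by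
      ext y
      rw [mem_component, mem_part_treePartition, rootOf_root p (mem_rootsIn.1 hr).2]
    rw [this]
    exact (treePartition p).part_mem.2 (mem_univ r)

theorem component_mem_parts (x : Fin n) :
    component p (rootOf p x) ∈ (treePartition p).parts := by
  rw [parts_treePartition]
  exact mem_image_of_mem _ (mem_rootsIn.2 ⟨mem_univ _, apply_rootOf p x⟩)

/-- The weighted partition into the trees of a forest, weighted by their numbers of descents. -/
noncomputable def ofForest : WeightedPartition n where
  partition := treePartition p
  weight B := if B ∈ (treePartition p).parts then (descentsIn B p.1).card else 0
  weight_lt B hB := by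
    rw [if_pos hB]
    rw [parts_treePartition] at hB
    obtain ⟨r, hr, rfl⟩ := mem_image.1 hB
    have hf := (mem_rootsIn.1 hr).2
    -- The root is its own parent, hence no descent; this makes the inequality strict.
    refine card_lt_card (ssubset_iff_of_subset (filter_subset _ _) |>.2 ⟨r, ?_, ?_⟩)
    · exact (mem_component p).2 (rootOf_root p hf)
    · exact fun h => (mem_descentsIn.1 h).2.ne hf.symm
  weight_eq_zero B hB := if_neg hB

theorem component_injOn (S : Set (Fin n)) (hS : ∀ r ∈ S, p.1 r = r) :
    Set.InjOn (component p) S := by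
  intro r hr r' _ h
  have : r ∈ component p r' := h ▸ (mem_component p).2 (rootOf_root p (hS r hr))
  rw [← (mem_component p).1 this, rootOf_root p (hS r hr)]

theorem component_subset_iff {D : Finset (Fin n)} (hD : ∀ x, p.1 x ∈ D ↔ x ∈ D) {r : Fin n}
    (hr : p.1 r = r) : component p r ⊆ D ↔ r ∈ D := by
  constructor
  · exact fun h => h ((mem_component p).2 (rootOf_root p hr))
  · intro h x hx
    rw [← rootOf_mem_iff p hD, (mem_component p).1 hx]
    exact h

theorem blocksIn_ofForest {D : Finset (Fin n)} (hD : ∀ x, p.1 x ∈ D ↔ x ∈ D) :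
    (ofForest p).blocksIn D = (rootsIn D p.1).image (component p) := by
  ext B
  rw [mem_blocksIn]
  change B ∈ (treePartition p).parts ∧ _ ↔ _
  rw [parts_treePartition, mem_image, mem_image]
  constructor
  · rintro ⟨⟨r, hr, rfl⟩, h⟩
    have hf := (mem_rootsIn.1 hr).2
    exact ⟨r, mem_rootsIn.2 ⟨(component_subset_iff p hD hf).1 h, hf⟩, rfl⟩
  · rintro ⟨r, hr, rfl⟩
    obtain ⟨hr, hf⟩ := mem_rootsIn.1 hr
    exact ⟨⟨r, mem_rootsIn.2 ⟨mem_univ r, hf⟩, rfl⟩, (component_subset_iff p hD hf).2 hr⟩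

theorem card_blocksIn_ofForest {D : Finset (Fin n)} (hD : ∀ x, p.1 x ∈ D ↔ x ∈ D) :
    ((ofForest p).blocksIn D).card = (rootsIn D p.1).card := by
  rw [blocksIn_ofForest p hD]
  exact card_image_of_injOn (component_injOn p _ fun r hr => (mem_rootsIn.1 hr).2)

theorem sum_weight_ofForest {D : Finset (Fin n)} (hD : ∀ x, p.1 x ∈ D ↔ x ∈ D) :
    ∑ A ∈ (ofForest p).blocksIn D, (ofForest p).weight A = (descentsIn D p.1).card := by
  have hmaps : ∀ x ∈ descentsIn D p.1, rootOf p x ∈ rootsIn D p.1 := fun x hx =>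
    mem_rootsIn.2 ⟨(rootOf_mem_iff p hD x).2 (mem_descentsIn.1 hx).1, apply_rootOf p x⟩
  rw [card_eq_sum_card_fiberwise hmaps, blocksIn_ofForest p hD,
    sum_image (component_injOn p _ fun r hr => (mem_rootsIn.1 hr).2)]
  refine sum_congr rfl fun r hr => ?_
  obtain ⟨hr, hf⟩ := mem_rootsIn.1 hr
  have hmem := component_mem_parts p r
  rw [rootOf_root p hf] at hmem
  change (if _ then _ else _) = _
  rw [if_pos hmem]
  congr 1
  ext x
  simp only [mem_descentsIn, mem_component, mem_filter]
  constructor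
  · rintro ⟨rfl, h⟩
    exact ⟨⟨(rootOf_mem_iff p hD x).1 hr, h⟩, rfl⟩
  · rintro ⟨⟨_, h⟩, rfl⟩
    exact ⟨rfl, h⟩

theorem treePartition_le_iff (Q : Finpartition (univ : Finset (Fin n))) :
    treePartition p ≤ Q ↔ ∀ D ∈ Q.parts, ∀ x, p.1 x ∈ D ↔ x ∈ D := by
  constructor
  · intro h D hD x
    obtain ⟨D', hD', hsub⟩ := h (component_mem_parts p x)
    have hx : x ∈ D' := hsub ((mem_component p).2 rfl)
    have hpx : p.1 x ∈ D' := hsub ((mem_component p).2 (rootOf_apply p x))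
    constructor
    · exact fun hD'' => Q.eq_of_mem_parts hD' hD hpx hD'' ▸ hx
    · exact fun hD'' => Q.eq_of_mem_parts hD' hD hx hD'' ▸ hpx
  · intro h B hB
    rw [parts_treePartition] at hB
    obtain ⟨r, hr, rfl⟩ := mem_image.1 hB
    exact ⟨Q.part r, Q.part_mem.2 (mem_univ r), (component_subset_iff p
      (h _ (Q.part_mem.2 (mem_univ r))) (mem_rootsIn.1 hr).2).2 (Q.mem_part (mem_univ r))⟩

/-- Inside a block `D` closed under `p`, the trees correspond to the roots and their weights add up
to the descents, so the allowed differences `0, ..., l - 1` have `l` equal to the number of roots in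
`D`. -/
theorem ofForest_le_iff (β : WeightedPartition n) :
    ofForest p ≤ β ↔ ∀ D ∈ β.partition.parts, (∀ x, p.1 x ∈ D ↔ x ∈ D) ∧
      (descentsIn D p.1).card ≤ β.weight D ∧
      β.weight D < (descentsIn D p.1).card + (rootsIn D p.1).card := by
  rw [le_def]
  change treePartition p ≤ _ ∧ _ ↔ _
  rw [treePartition_le_iff, ← forall₂_and]
  refine forall₂_congr fun D _ => and_congr_right fun hD => ?_
  rw [card_blocksIn_ofForest p hD, sum_weight_ofForest p hD]
  constructor
  · rintro ⟨d, hd, h⟩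
    omega
  · exact fun h => ⟨β.weight D - (descentsIn D p.1).card, by omega, by omega⟩

theorem zeroHat_le (β : WeightedPartition n) : zeroHat n ≤ β := by
  have h : zeroHat n ≤ β ↔ _ := le_def _ _
  refine h.2 ⟨bot_le, fun B hB => ⟨β.weight B, ?_, ?_⟩⟩
  · have : (zeroHat n).blocksIn B = B.map ⟨singleton, singleton_injective⟩ := by
      ext A
      simp only [mem_blocksIn, zeroHat, Finpartition.mem_bot_iff, mem_map, mem_univ, true_and,
        Function.Embedding.coeFn_mk]
      constructor
      · rintro ⟨⟨x, rfl⟩, hx⟩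
        exact ⟨x, by simpa using hx, rfl⟩
      · rintro ⟨x, hx, rfl⟩
        exact ⟨⟨x, rfl⟩, by simpa using hx⟩
    rw [this, card_map]
    exact β.weight_lt B hB
  · simp [zeroHat]

theorem eq_zeroHat_of_card_le_one {β : WeightedPartition n}
    (h : ∀ B ∈ β.partition.parts, B.card ≤ 1) : β = zeroHat n := by
  refine le_antisymm' ?_ (zeroHat_le β)
  have hs : ∀ B ∈ β.partition.parts, ∃ x, B = {x} := fun B hB =>
    card_eq_one.1 (le_antisymm (h B hB) (card_pos.2 (β.partition.nonempty_of_mem_parts hB)))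
  have hp : β.partition ≤ (zeroHat n).partition := by
    intro B hB
    obtain ⟨x, rfl⟩ := hs B hB
    exact ⟨{x}, Finpartition.mem_bot_iff.2 ⟨x, mem_univ x, rfl⟩, le_rfl⟩
  have hw : ∀ B, β.weight B = 0 := by
    intro B
    by_cases hB : B ∈ β.partition.parts
    · have := β.weight_lt B hB
      have := h B hB
      omega
    · exact β.weight_eq_zero B hB
  refine (le_def _ _).2 ⟨hp, fun B hB => ⟨0, ?_, by simp [hw, zeroHat]⟩⟩
  obtain ⟨x, -, rfl⟩ := Finpartition.mem_bot_iff.1 hB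
  refine card_pos.2 ⟨β.partition.part x, mem_blocksIn.2 ⟨β.partition.part_mem.2 (mem_univ x), ?_⟩⟩
  obtain ⟨y, hy⟩ := hs _ (β.partition.part_mem.2 (mem_univ x))
  have := β.partition.mem_part (mem_univ x)
  rw [hy, mem_singleton] at this
  rw [hy, this]

/-- The signed number of forests below `β` vanishes if `β` is not the minimum. -/
theorem sum_ofForest_le (β : WeightedPartition n) :
    (open Classical in ∑ p : {p : Fin n → Fin n // IsForest p} with ofForest p ≤ β,
      (-1 : ℤ) ^ (n + (rootsIn univ p.1).card)) = if zeroHat n = β then 1 else 0 := by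
  classical
  split_ifs with hβ
  · subst hβ
    have : (univ.filter fun p : {p : Fin n → Fin n // IsForest p} => ofForest p ≤ zeroHat n) =
        {⟨id, fun x => .fixed x rfl⟩} := by
      ext p
      rw [mem_filter, mem_singleton, ofForest_le_iff]
      constructor
      · rintro ⟨-, h⟩
        refine Subtype.ext (funext fun x => ?_)
        have := (h {x} (Finpartition.mem_bot_iff.2 ⟨x, mem_univ x, rfl⟩)).1 x
        simpa using this
      · rintro rfl
        refine ⟨mem_univ _, fun D hD => ?_⟩
        obtain ⟨x, -, rfl⟩ := Finpartition.mem_bot_iff.1 hD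
        simp [descentsIn, rootsIn, zeroHat]
    rw [this, sum_singleton]
    simp [rootsIn, ← two_mul]
  · obtain ⟨C, hC, hcard⟩ : ∃ C ∈ β.partition.parts, 1 < C.card := by
      by_contra! h
      exact hβ (eq_zeroHat_of_card_le_one h).symm
    have hdisj : ∀ D ∈ β.partition.parts, D ≠ C → ∀ x ∈ D, x ∉ C := fun D hD hne x hx hxC =>
      hne (β.partition.eq_of_mem_parts hD hC hx hxC)
    -- `R` collects the conditions at the blocks other than `C`. Invariance is asked only for `x ∉
    -- C`, so that `R`, and with it `g`, depends only on the values of `q` off `C`; for `x ∈ C` it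
    -- follows from the invariance of `C`.
    let R : (Fin n → Fin n) → Prop := fun q => ∀ D ∈ β.partition.parts, D ≠ C →
      (∀ x ∉ C, q x ∈ D ↔ x ∈ D) ∧ (descentsIn D q).card ≤ β.weight D ∧
        β.weight D < (descentsIn D q).card + (rootsIn D q).card
    let g : (Fin n → Fin n) → ℤ := fun q =>
      if R q then (-1) ^ (n + (rootsIn Cᶜ q).card) else 0
    have hroots : ∀ q q' : Fin n → Fin n, ∀ D : Finset (Fin n), (∀ x ∈ D, q x = q' x) →
        rootsIn D q = rootsIn D q' := fun q q' D h =>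
      filter_congr fun x hx => by rw [h x hx]
    have hdesc : ∀ q q' : Fin n → Fin n, ∀ D : Finset (Fin n), (∀ x ∈ D, q x = q' x) →
        descentsIn D q = descentsIn D q' := fun q q' D h =>
      filter_congr fun x hx => by rw [h x hx]
    have hg : ∀ q q' : Fin n → Fin n, (∀ x ∉ C, q x = q' x) → g q = g q' := by
      intro q q' h
      have hR : R q ↔ R q' := by
        refine forall₃_congr fun D hD hne => ?_
        have hD' : ∀ x ∈ D, q x = q' x := fun x hx => h x (hdisj D hD hne x hx)
        rw [hroots q q' D hD', hdesc q q' D hD']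
        refine and_congr_left fun _ => forall₂_congr fun x hx => ?_
        rw [h x hx]
      simp only [g, hR, hroots q q' Cᶜ fun x hx => h x (by simpa using hx)]
    have key := sum_forest_eq_zero hcard (v := β.weight C) (g := g) hg (F := univ.filter fun q =>
      IsForest q ∧ (∀ x, q x ∈ C ↔ x ∈ C) ∧ (descentsIn C q).card ≤ β.weight C ∧
        β.weight C < (descentsIn C q).card + (rootsIn C q).card) (by simp)
    have hsum := sum_filter (M := ℤ) (s := univ.filter fun q : Fin n → Fin n =>
      IsForest q ∧ (∀ x, q x ∈ C ↔ x ∈ C) ∧ (descentsIn C q).card ≤ β.weight C ∧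
        β.weight C < (descentsIn C q).card + (rootsIn C q).card) R
      fun q => (-1) ^ (rootsIn C q).card * (-1) ^ (n + (rootsIn Cᶜ q).card)
    rw [← key]
    refine Eq.trans ?_ (hsum.trans (sum_congr rfl fun q _ => ?_))
    swap
    · by_cases h : R q <;> simp [g, h]
    refine sum_bij (fun p _ => p.1) ?_ (fun _ _ _ _ h => Subtype.ext h) ?_ ?_
    · intro p hp
      have h := (ofForest_le_iff p β).1 (mem_filter.1 hp).2
      refine mem_filter.2 ⟨mem_filter.2 ⟨mem_univ _, p.2, h C hC⟩, fun D hD _ => ?_⟩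
      exact ⟨fun x _ => (h D hD).1 x, (h D hD).2⟩
    · intro q hq
      obtain ⟨hq, hqR⟩ := mem_filter.1 hq
      obtain ⟨-, hqf, hqC⟩ := mem_filter.1 hq
      refine ⟨⟨q, hqf⟩, mem_filter.2 ⟨mem_univ _, (ofForest_le_iff _ β).2 fun D hD => ?_⟩, rfl⟩
      by_cases hne : D = C
      · exact hne ▸ hqC
      · refine ⟨fun x => ?_, (hqR D hD hne).2⟩
        by_cases hx : x ∈ C
        · exact iff_of_false (fun h => hdisj D hD hne _ h ((hqC.1 x).2 hx))
            fun h => hdisj D hD hne _ h hx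
        · exact (hqR D hD hne).1 x hx
    · intro p _
      have : (rootsIn univ p.1).card = (rootsIn C p.1).card + (rootsIn Cᶜ p.1).card := by
        rw [← card_union_of_disjoint (show Disjoint (rootsIn C p.1) (rootsIn Cᶜ p.1) from
          disjoint_filter_filter (disjoint_compl_right (a := C)))]
        congr 1
        ext x
        simp only [mem_union, mem_rootsIn, mem_univ, mem_compl]
        tauto
      rw [this]
      ring

/-- Both sides have the same sums over every interval `[0̂, β]`; by induction the terms below `β`
agree, and hence so do the terms at `β`. -/
theorem mu_zeroHat (β : WeightedPartition n) :
    IncidenceAlgebra.mu ℤ (zeroHat n) β =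
      open Classical in ∑ p : {p : Fin n → Fin n // IsForest p} with ofForest p = β,
        (-1 : ℤ) ^ (n + (rootsIn univ p.1).card) := by
  classical
  induction β using WellFoundedLT.induction with
  | ind β ih =>
    have h1 := IncidenceAlgebra.sum_Icc_mu_right (𝕜 := ℤ) (zeroHat n) β
    have h2 := sum_ofForest_le β
    rw [← sum_fiberwise_of_maps_to (t := Icc (zeroHat n) β) (g := ofForest)
      (fun p hp => mem_Icc.2 ⟨zeroHat_le _, (mem_filter.1 hp).2⟩), ← h1] at h2
    have hmem : β ∈ Icc (zeroHat n) β := mem_Icc.2 ⟨zeroHat_le β, le_rfl⟩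
    rw [← add_sum_erase _ _ hmem, ← add_sum_erase _ _ hmem] at h2
    have hfib : ∀ α ≤ β, (univ.filter fun p : {p : Fin n → Fin n // IsForest p} =>
        ofForest p ≤ β).filter (fun p => ofForest p = α) = univ.filter fun p => ofForest p = α := by
      intro α hα
      rw [filter_filter]
      exact filter_congr fun p _ => ⟨fun h => h.2, fun h => ⟨h ▸ hα, h⟩⟩
    have hrest := sum_congr (M := ℤ) rfl fun α (hα : α ∈ (Icc (zeroHat n) β).erase β) => by
      have hlt : α < β := lt_of_le_of_ne (mem_Icc.1 (mem_erase.1 hα).2).2 (mem_erase.1 hα).1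
      exact ih α hlt
    rw [hrest, hfib β le_rfl] at h2
    have hrest' := sum_congr (M := ℤ) rfl fun α (hα : α ∈ (Icc (zeroHat n) β).erase β) =>
      congrArg (fun s => ∑ p ∈ s, (-1 : ℤ) ^ (n + (rootsIn univ p.1).card))
        (hfib α (mem_Icc.1 (mem_erase.1 hα).2).2)
    rw [hrest'] at h2
    exact (add_right_cancel h2).symm

theorem ofForest_eq_single_iff {i : ℕ} (hi : i < n) :
    ofForest p = single n i hi ↔
      (rootsIn univ p.1).card = 1 ∧ (descentsIn univ p.1).card = i := by
  have huniv : ∀ x, p.1 x ∈ (univ : Finset (Fin n)) ↔ x ∈ univ := by simp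
  have hparts : (single n i hi).partition.parts = {univ} := rfl
  have hb : (single n i hi).blocksIn univ = {univ} := blocksIn_self _ (by simp [hparts])
  constructor
  · intro h
    rw [← card_blocksIn_ofForest p huniv, ← sum_weight_ofForest p huniv, h, hb]
    simp [single]
  · rintro ⟨hr, hd⟩
    have hle : ofForest p ≤ single n i hi := by
      rw [ofForest_le_iff]
      intro D hD
      rw [hparts, mem_singleton] at hD
      subst hD
      have hw : (single n i hi).weight univ = i := by simp [single]
      exact ⟨huniv, by omega, by omega⟩
    obtain ⟨r, hr⟩ := card_eq_one.1 hr
    have hroot : ∀ x, rootOf p x = r := fun x =>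
      mem_singleton.1 (hr ▸ mem_rootsIn.2 ⟨mem_univ _, apply_rootOf p x⟩)
    have hp : (ofForest p).partition.parts = {univ} := by
      change (treePartition p).parts = _
      rw [parts_treePartition, hr, image_singleton]
      congr 1
      ext x
      simp [mem_component, hroot]
    have hb' : (ofForest p).blocksIn univ = {univ} := blocksIn_self _ (by simp [hp])
    have hw := sum_weight_ofForest p huniv
    rw [hb', sum_singleton, hd] at hw
    refine le_antisymm' hle ⟨(Finpartition.ext (by rw [hp, hparts]) :
      (single n i hi).partition = (ofForest p).partition).le, fun B hB => ⟨0, ?_, ?_⟩⟩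
    all_goals
      rw [hp, mem_singleton] at hB
      subst hB
      rw [hb]
    · simp
    · simp [hw, single]

end WeightedPartition

/-! ### Rooted trees as parent maps with one fixed point. -/

namespace LabeledRootedTree

open Finset

variable {n : ℕ}

/-- A geodesic to the root through either parent is a path from `x`, and a tree has only one such
path. -/
theorem IsParent.unique {T : LabeledRootedTree n} {x y z : Fin n} (hy : T.IsParent y x)
    (hz : T.IsParent z x) : y = z := by
  obtain ⟨w, hw⟩ := T.isTree.connected.exists_walk_length_eq_dist y T.root
  obtain ⟨w', hw'⟩ := T.isTree.connected.exists_walk_length_eq_dist z T.root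
  have h : (SimpleGraph.Walk.cons hy.1 w).IsPath :=
    SimpleGraph.Walk.isPath_of_length_eq_dist _ (by simp [hw, hy.2])
  have h' : (SimpleGraph.Walk.cons hz.1 w').IsPath :=
    SimpleGraph.Walk.isPath_of_length_eq_dist _ (by simp [hw', hz.2])
  have := (T.isTree.existsUnique_path x T.root).unique h h'
  simpa using congrArg SimpleGraph.Walk.snd this

theorem exists_isParent (T : LabeledRootedTree n) {x : Fin n} (hx : x ≠ T.root) :
    ∃ y, T.IsParent y x := by
  obtain ⟨w, hw⟩ := T.isTree.connected.exists_walk_length_eq_dist x T.root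
  cases w with
  | nil => exact absurd rfl hx
  | @cons _ y _ h w =>
    refine ⟨y, h, ?_⟩
    have h1 := SimpleGraph.dist_le w
    rw [SimpleGraph.Walk.length_cons] at hw
    rcases T.isTree.dist_eq_dist_add_one_of_adj T.root h with h2 | h2 <;>
      rw [SimpleGraph.dist_comm (u := T.root), SimpleGraph.dist_comm (u := T.root)] at h2 <;> omega

theorem not_isParent_root (T : LabeledRootedTree n) (y : Fin n) : ¬ T.IsParent y T.root := by
  intro h
  have := h.2
  simp at this

theorem adj_iff_isParent (T : LabeledRootedTree n) (x y : Fin n) :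
    T.graph.Adj x y ↔ T.IsParent y x ∨ T.IsParent x y := by
  constructor
  · intro h
    have := T.isTree.dist_eq_dist_add_one_of_adj T.root h
    rw [SimpleGraph.dist_comm (u := T.root), SimpleGraph.dist_comm (u := T.root)] at this
    exact this.imp (fun h' => ⟨h, h'⟩) fun h' => ⟨h.symm, h'⟩
  · rintro (h | h)
    · exact h.1
    · exact h.1.symm

open Classical in
/-- The parent map of a rooted tree, with the root as its fixed point. -/
noncomputable def parent (T : LabeledRootedTree n) (x : Fin n) : Fin n :=
  if hx : x = T.root then x else (T.exists_isParent hx).choose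

theorem parent_root (T : LabeledRootedTree n) : T.parent T.root = T.root := by
  simp [parent]

theorem isParent_parent (T : LabeledRootedTree n) {x : Fin n} (hx : x ≠ T.root) :
    T.IsParent (T.parent x) x := by
  rw [parent, dif_neg hx]
  exact (T.exists_isParent hx).choose_spec

theorem isParent_iff (T : LabeledRootedTree n) (x y : Fin n) :
    T.IsParent y x ↔ x ≠ T.root ∧ T.parent x = y := by
  constructor
  · intro h
    have hx : x ≠ T.root := fun hx => T.not_isParent_root y (hx ▸ h)
    exact ⟨hx, (T.isParent_parent hx).unique h⟩
  · rintro ⟨hx, rfl⟩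
    exact T.isParent_parent hx

theorem parent_eq_self_iff (T : LabeledRootedTree n) (x : Fin n) :
    T.parent x = x ↔ x = T.root := by
  constructor
  · intro h
    by_contra hx
    have := (T.isParent_parent hx).1
    rw [h] at this
    exact this.ne rfl
  · rintro rfl
    exact T.parent_root

theorem isForest_parent (T : LabeledRootedTree n) : IsForest T.parent := by
  intro x
  induction h : T.graph.dist x T.root generalizing x with
  | zero =>
    have hx : x = T.root := (T.isTree.connected.dist_eq_zero_iff).1 h
    exact .fixed x (hx ▸ T.parent_root)
  | succ k ih =>
    have hx : x ≠ T.root := by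
      rintro rfl
      simp at h
    refine .step x (ih _ ?_)
    have := (T.isParent_parent hx).2
    omega

theorem descents_eq (T : LabeledRootedTree n) : T.descents = descentsIn univ T.parent := by
  ext x
  simp only [descents, Set.mem_ofPred_eq, isParent_iff, mem_coe, mem_descentsIn, mem_univ, true_and]
  constructor
  · rintro ⟨y, ⟨-, rfl⟩, h⟩
    exact h
  · intro h
    exact ⟨_, ⟨fun hx => h.ne ((T.parent_eq_self_iff x).2 hx).symm, rfl⟩, h⟩

theorem rootsIn_parent (T : LabeledRootedTree n) : rootsIn univ T.parent = {T.root} := by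
  ext x
  simp [mem_rootsIn, parent_eq_self_iff]

theorem parent_injective : Function.Injective (parent (n := n)) := by
  intro T T' h
  have hr : T.root = T'.root := by rw [← parent_eq_self_iff, ← h, parent_root]
  have hg : T.graph = T'.graph := by
    ext x y
    simp only [adj_iff_isParent, isParent_iff, h, hr]
  cases T
  cases T'
  simp_all

/-- The graph that joins every vertex to its image under `p`. -/
def parentGraph (p : Fin n → Fin n) : SimpleGraph (Fin n) := SimpleGraph.fromRel fun x y => p x = y

theorem parentGraph_adj {p : Fin n → Fin n} {x y : Fin n} :
    (parentGraph p).Adj x y ↔ x ≠ y ∧ (p x = y ∨ p y = x) :=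
  SimpleGraph.fromRel_adj _ _ _

theorem _root_.IsForest.eq_of_apply_apply {p : Fin n → Fin n} (hp : IsForest p) {x : Fin n}
    (h : p (p x) = x) : p x = x :=
  ((hp x).eq_of_inOrbit (InOrbit.refl x).step ⟨1, h⟩).symm

theorem parentGraph_isTree {p : Fin n → Fin n} (hp : IsForest p) {r : Fin n}
    (hr : ∀ x, p x = x ↔ x = r) : (parentGraph p).IsTree := by
  rw [SimpleGraph.isTree_iff_connected_and_card]
  constructor
  · have hreach : ∀ x, (parentGraph p).Reachable x r := by
      intro x
      induction hp x with
      | fixed x h => rw [(hr x).1 h]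
      | step x _ ih =>
        by_cases hx : p x = x
        · rw [(hr x).1 hx]
        · exact (SimpleGraph.Adj.reachable (parentGraph_adj.2 ⟨Ne.symm hx, .inl rfl⟩)).trans ih
    exact (SimpleGraph.connected_iff _).2 ⟨fun x y => (hreach x).trans (hreach y).symm, ⟨r⟩⟩
  -- Each edge joins a unique non-root to its parent, so there is one edge fewer than there are
  -- vertices; a repeated edge would force a 2-cycle of `p`.
  · have hbij : Function.Bijective (fun x : {x // x ≠ r} =>
        (⟨s(x.1, p x.1), parentGraph_adj.2 ⟨fun h => x.2 ((hr _).1 h.symm), .inl rfl⟩⟩ :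
          (parentGraph p).edgeSet)) := by
      constructor
      · rintro ⟨x, hx⟩ ⟨y, hy⟩ h
        rcases Sym2.eq_iff.1 (congrArg Subtype.val h) with ⟨h, -⟩ | ⟨h, h'⟩
        · exact Subtype.ext h
        · refine absurd ((hr x).1 (hp.eq_of_apply_apply ?_)) hx
          exact (congrArg p h').trans h.symm
      · rintro ⟨e, he⟩
        induction e with
        | h x y =>
          obtain ⟨hne, h | h⟩ := parentGraph_adj.1 he
          · exact ⟨⟨x, fun hx => hne (((hr x).2 hx).symm.trans h)⟩, by simp [h]⟩
          · exact ⟨⟨y, fun hy => hne (h.symm.trans ((hr y).2 hy))⟩, by simp [h, Sym2.eq_swap]⟩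
    rw [← Nat.card_congr (Equiv.ofBijective _ hbij), Nat.card_eq_fintype_card,
      Nat.card_eq_fintype_card, Fintype.card_subtype_compl, Fintype.card_subtype_eq,
      Nat.sub_add_cancel (Fintype.card_pos_iff.2 ⟨r⟩)]

theorem exists_parent_eq {p : Fin n → Fin n} (hp : IsForest p)
    (hcard : (rootsIn univ p).card = 1) : ∃ T : LabeledRootedTree n, T.parent = p := by
  obtain ⟨r, hr⟩ := card_eq_one.1 hcard
  have hr : ∀ x, p x = x ↔ x = r := fun x => by
    simpa [mem_rootsIn] using Finset.ext_iff.1 hr x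
  let T : LabeledRootedTree n := ⟨parentGraph p, parentGraph_isTree hp hr, r⟩
  have hadj : ∀ x, x ≠ r → T.graph.Adj x (p x) := fun x hx =>
    parentGraph_adj.2 ⟨fun h => hx ((hr x).1 h.symm), .inl rfl⟩
  -- Distances in the graph cannot decrease away from `p`: if `p x` were a child of `x`, then, its
  -- parent being unique, `p (p x)` would be a child of `p x`, and so on up to the root, which has
  -- no parent.
  have hno : ∀ x, ¬ T.IsParent x (p x) := by
    intro x
    induction hp x with
    | fixed x h =>
      intro h'
      rw [h] at h'
      exact h'.1.ne rfl
    | step x _ ih =>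
      intro h
      by_cases hx : p x = r
      · rw [hx] at h
        exact T.not_isParent_root x h
      · rcases (T.adj_iff_isParent _ _).1 (hadj _ hx) with h' | h'
        · have := hp.eq_of_apply_apply (h'.unique h)
          rw [this] at h
          exact h.1.ne rfl
        · exact ih h'
  refine ⟨T, funext fun x => ?_⟩
  by_cases hx : x = r
  · rw [(hr x).2 hx, parent_eq_self_iff]
    exact hx
  · rcases (T.adj_iff_isParent _ _).1 (hadj _ hx) with h | h
    · exact ((T.isParent_iff _ _).1 h).2
    · exact absurd h (hno x)

theorem ncard_withDescents (n i : ℕ) :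
    (withDescents n i).ncard = {p : {p : Fin n → Fin n // IsForest p} |
      (rootsIn univ p.1).card = 1 ∧ (descentsIn univ p.1).card = i}.ncard := by
  refine Set.ncard_congr (fun T _ => ⟨T.parent, T.isForest_parent⟩) ?_ ?_ ?_
  · intro T hT
    have hT : T.descents.ncard = i := hT
    rw [descents_eq, Set.ncard_coe_finset] at hT
    exact ⟨by rw [rootsIn_parent, card_singleton], hT⟩
  · exact fun T T' _ _ h => parent_injective (congrArg Subtype.val h)
  · rintro ⟨p, hp⟩ ⟨h1, h2⟩
    obtain ⟨T, rfl⟩ := exists_parent_eq hp h1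
    refine ⟨T, ?_, rfl⟩
    change T.descents.ncard = i
    rw [descents_eq, Set.ncard_coe_finset]
    exact h2

end LabeledRootedTree

theorem mainTheorem4 (n : ℕ) (hn : 1 ≤ n) (i : ℕ) (hi : i ≤ n - 1) :
    IncidenceAlgebra.mu ℤ (WeightedPartition.zeroHat n)
        (WeightedPartition.single n i (Nat.lt_of_le_pred hn hi)) =
      (-1 : ℤ) ^ (n - 1) * ((LabeledRootedTree.withDescents n i).ncard : ℤ) := by
  classical
  rw [WeightedPartition.mu_zeroHat, LabeledRootedTree.ncard_withDescents,
    Set.ncard_eq_toFinset_card', Set.toFinset_ofPred, mul_comm, ← nsmul_eq_mul,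
    ← Finset.sum_const]
  refine Finset.sum_congr (by simp only [WeightedPartition.ofForest_eq_single_iff]) fun p hp => ?_
  rw [(Finset.mem_filter.1 hp).2.1]
  obtain ⟨m, rfl⟩ := Nat.exists_eq_add_of_le hn
  rw [Nat.add_sub_cancel_left, add_right_comm, pow_add]
  norm_num
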